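/- **Definitions.** All sets below are subsets of $\mathbb{R}^r$ with its Euclidean inner product. A polytope is the convex hull of finitely many points, and $\operatorname{ext}$ denotes the set of extreme points. For a matrix $H$, $\operatorname{conv}(H)$ is the convex hull of its columns. A polytopic matrix factorization (PMF) of size $r$ of $X\in\mathbb{R}^{m\times n}$ is a quadruple $(W,H,\mathcal P_W,\mathcal P_H)$ such that $X=WH$, $W\in\mathbb{R}^{m\times r}$, $H\in\mathbb{R}^{r\times n}$, all rows of $W$ lie in the polytope $\mathcal P_W\subset\mathbb{R}^r$, and all columns of $H$ lie in the polytope $\mathcal P_H\subset\mathbb{R}^r$. A signed permutation is a matrix $D\Pi$ with $\Pi$ a permutation matrix and $D$ a diagonal matrix with diagonal entries in $\{-1,1\}$. The PMF is identifiable if for every PMF $(W_*,H_*,\mathcal P_W,\mathcal P_H)$ of $X$ of the same size $r$ there are such $\Pi$ and $D$ with $W_*=W\Pi^\top D^{-1}$ and $H_*=D\Pi H$. For a polytope $\mathcal P$ with affine hull $A$ and direction space $V=A-A$ (so $A=V=\mathbb{R}^r$ if $\mathcal P$ has full dimension), consider the ellipsoids $\{x\in A : (x-c)^\top E(x-c)\le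 r\}$ with $E$ positive definite and $c\in A$; the maximum-volume inscribed ellipsoid (MVIE) $\mathcal E_{\mathcal P}$ is the one contained in $\mathcal P$ of largest $\dim(A)$-dimensional volume, and $g_{\mathcal P}$ is its centre. For $\mathcal S\subseteq A$ and $g\in A$ let $\mathcal S^{*,g}=\{x\in V : \langle x,y-g\rangle\le 1\ \text{for all } y\in\mathcal S\}$. Boundaries $\operatorname{bd}$ of such polars are taken in $V$. A matrix $H$ with $r$ rows satisfies, relative to $\mathcal P$, * [PMF.SSC1] if $\mathcal P\supseteq\operatorname{conv}(H)\supseteq\mathcal E_{\mathcal P}$; * [PMF.SSC2] if $\operatorname{conv}(H)^{*,g_{\mathcal P}}\cap\operatorname{bd}(\mathcal E_{\mathcal P}^{*,g_{\mathcal P}})=\operatorname{ext}(\mathcal P^{*,g_{\mathcal P}})$. $H$ is a sufficiently scattered factor (SSF) for $\mathcal P$ if it satisfies both. A set $\mathcal X\subseteq\mathbb{R}^r$ is permutation-and/or-sign-only invariant (PSOI) if every matrix $A\in\mathbb{R}^{r\times r}$ with $A(\mathcal X)=\mathcal X$ is a signed permutation. Two sets $\mathcal X,\mathcal Y\subseteq\mathbb{R}^r$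 are mutually PSOI if every invertible $A\in\mathbb{R}^{r\times r}$ with $A^{-\top}(\mathcal X)=\mathcal X$ and $A(\mathcal Y)=\mathcal Y$ is a signed permutation. **Statement.** Let $(W,H,\mathcal P_W,\mathcal P_H)$ be a PMF of $X$ of size $r=\operatorname{rank}(X)$. 1. Suppose that $W^\top$ satisfies [PMF.SSC1] relative to $\mathcal P_W$ and $H$ satisfies [PMF.SSC1] relative to $\mathcal P_H$, and that at least one of the following holds: (i) $W^\top$ satisfies [PMF.SSC2] relative to $\mathcal P_W$ and $\operatorname{ext}(\mathcal P_W)$ is a PSOI set; (ii) $H$ satisfies [PMF.SSC2] relative to $\mathcal P_H$ and $\operatorname{ext}(\mathcal P_H)$ is a PSOI set. Then the PMF $(W,H,\mathcal P_W,\mathcal P_H)$ of $X$ is identifiable. 2. Suppose that $W^\top$ is an SSF for $\mathcal P_W$, $H$ is an SSF for $\mathcal P_H$, and $\operatorname{ext}(\mathcal P_W)$, $\operatorname{ext}(\mathcal P_H)$ are mutually PSOI. Then the PMF $(W,H,\mathcal P_W,\mathcal P_H)$ of $X$ is identifiable. -/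

import Mathlib

open scoped Matrix RealInnerProductSpace MeasureTheory

noncomputable section

namespace PMF

/-- A convex polytope in `ℝ^r`, in V-form: the convex hull of finitely many points. -/
def IsPolytope {r : ℕ} (P : Set (EuclideanSpace ℝ (Fin r))) : Prop :=
  ∃ V : Finset (EuclideanSpace ℝ (Fin r)),
    P = convexHull ℝ (V : Set (EuclideanSpace ℝ (Fin r)))

/-- `Conv H`: the convex hull of the columns of the matrix `H`. -/
def convCols {r n : ℕ} (H : Matrix (Fin r) (Fin n) ℝ) : Set (EuclideanSpace ℝ (Fin r)) :=
  convexHull ℝ (Set.range fun j : Fin n => WithLp.toLp 2 (fun i => H i j))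

/-- `(W, H, PW, PH)` is a polytopic matrix factorization of `X` of size `r`: `X = W H`, the rows of
`W` lie in the polytope `PW` and the columns of `H` lie in the polytope `PH`. -/
structure IsPMF {m n r : ℕ} (X : Matrix (Fin m) (Fin n) ℝ) (W : Matrix (Fin m) (Fin r) ℝ)
    (H : Matrix (Fin r) (Fin n) ℝ) (PW PH : Set (EuclideanSpace ℝ (Fin r))) : Prop where
  polytope_W : IsPolytope PW
  polytope_H : IsPolytope PH
  eq_mul : X = W * H
  row_mem : ∀ i, WithLp.toLp 2 (fun k => W i k) ∈ PW
  col_mem : ∀ j, WithLp.toLp 2 (fun k => H k j) ∈ PH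

/-- Every PMF `(W', H', PW, PH)` of `X` of the same size as the PMF `(W, H, PW, PH)` is of the form
`W' = W Πᵀ D⁻¹`, `H' = D Π H` with `Π` a permutation matrix and `D` diagonal with entries `±1`. -/
def IsIdentifiable {m n r : ℕ} (X : Matrix (Fin m) (Fin n) ℝ) (W : Matrix (Fin m) (Fin r) ℝ)
    (H : Matrix (Fin r) (Fin n) ℝ) (PW PH : Set (EuclideanSpace ℝ (Fin r))) : Prop :=
  ∀ (W' : Matrix (Fin m) (Fin r) ℝ) (H' : Matrix (Fin r) (Fin n) ℝ), IsPMF X W' H' PW PH →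
    ∃ (σ : Equiv.Perm (Fin r)) (d : Fin r → ℝ), (∀ i, d i = 1 ∨ d i = -1) ∧
      W' = W * (σ.permMatrix ℝ)ᵀ * (Matrix.diagonal d)⁻¹ ∧
      H' = Matrix.diagonal d * σ.permMatrix ℝ * H

/-- The ellipsoid `{x | (x - c)ᵀ E (x - c) ≤ r}`, taken inside an affine subspace `A`
(all of `ℝ^r` when `A = ⊤`). -/
def ellipsoidIn {r : ℕ} (A : AffineSubspace ℝ (EuclideanSpace ℝ (Fin r)))
    (E : Matrix (Fin r) (Fin r) ℝ) (c : EuclideanSpace ℝ (Fin r)) :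
    Set (EuclideanSpace ℝ (Fin r)) :=
  {x | x ∈ A ∧ (x - c).ofLp ⬝ᵥ (E *ᵥ (x - c).ofLp) ≤ (r : ℝ)}

/-- The volume, inside the affine subspace `A`, of a subset of `A`: the Euclidean Hausdorff measure
of dimension `dim A`. It is Lebesgue measure on `ℝ^r` when `A = ⊤`. -/
def volIn {r : ℕ} (A : AffineSubspace ℝ (EuclideanSpace ℝ (Fin r)))
    (S : Set (EuclideanSpace ℝ (Fin r))) : ENNReal :=
  μHE[Module.finrank ℝ A.direction] S

/-- `E` (positive definite) and `c` describe an ellipsoid of the affine hull of `P` that is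
inscribed in `P`. -/
structure IsInscribed {r : ℕ} (P : Set (EuclideanSpace ℝ (Fin r)))
    (E : Matrix (Fin r) (Fin r) ℝ) (c : EuclideanSpace ℝ (Fin r)) : Prop where
  posDef : E.PosDef
  center_mem : c ∈ affineSpan ℝ P
  subset : ellipsoidIn (affineSpan ℝ P) E c ⊆ P

/-- The ellipsoid described by `E` and `g` is the maximum-volume inscribed ellipsoid (MVIE) of `P`;
`g` is its centre. Ellipsoids and volumes are those of the affine hull of `P`. -/
structure IsMVIE {r : ℕ} (P : Set (EuclideanSpace ℝ (Fin r)))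
    (E : Matrix (Fin r) (Fin r) ℝ) (g : EuclideanSpace ℝ (Fin r)) : Prop where
  inscribed : IsInscribed P E g
  max_vol : ∀ (E' : Matrix (Fin r) (Fin r) ℝ) (c' : EuclideanSpace ℝ (Fin r)),
    IsInscribed P E' c' →
      volIn (affineSpan ℝ P) (ellipsoidIn (affineSpan ℝ P) E' c') ≤
        volIn (affineSpan ℝ P) (ellipsoidIn (affineSpan ℝ P) E g)

/-- The polar of `S` with respect to the point `g`, taken inside the linear subspace `V`
(all of `ℝ^r` when `V = ⊤`). -/
def polarIn {r : ℕ} (V : Submodule ℝ (EuclideanSpace ℝ (Fin r)))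
    (g : EuclideanSpace ℝ (Fin r)) (S : Set (EuclideanSpace ℝ (Fin r))) :
    Set (EuclideanSpace ℝ (Fin r)) :=
  {x | x ∈ V ∧ ∀ y ∈ S, ⟪x, y - g⟫ ≤ 1}

/-- Condition [PMF.SSC1]: `P ⊇ Conv H ⊇ (MVIE of P)`. -/
def SSC1 {r n : ℕ} (P : Set (EuclideanSpace ℝ (Fin r))) (H : Matrix (Fin r) (Fin n) ℝ) : Prop :=
  convCols H ⊆ P ∧ ∃ (E : Matrix (Fin r) (Fin r) ℝ) (g : EuclideanSpace ℝ (Fin r)),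
    IsMVIE P E g ∧ ellipsoidIn (affineSpan ℝ P) E g ⊆ convCols H

/-- Condition [PMF.SSC2]: with polars taken with respect to the centre `g` of the MVIE of `P`, the
polar of `Conv H` meets the boundary of the polar of the MVIE exactly in the vertices of the polar
of `P`. Polars and boundary are relative to the direction space of the affine hull of `P`;
`intrinsicFrontier` is the usual boundary if `P` has full dimension. -/
def SSC2 {r n : ℕ} (P : Set (EuclideanSpace ℝ (Fin r))) (H : Matrix (Fin r) (Fin n) ℝ) : Prop :=
  ∃ (E : Matrix (Fin r) (Fin r) ℝ) (g : EuclideanSpace ℝ (Fin r)), IsMVIE P E g ∧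
    polarIn (affineSpan ℝ P).direction g (convCols H) ∩
        intrinsicFrontier ℝ
          (polarIn (affineSpan ℝ P).direction g (ellipsoidIn (affineSpan ℝ P) E g)) =
      Set.extremePoints ℝ (polarIn (affineSpan ℝ P).direction g P)

/-- A sufficiently scattered factor (SSF) corresponding to `P`. -/
def IsSSF {r n : ℕ} (P : Set (EuclideanSpace ℝ (Fin r))) (H : Matrix (Fin r) (Fin n) ℝ) : Prop :=
  SSC1 P H ∧ SSC2 P H

/-- A signed permutation: a matrix `D Π`, `Π` a permutation matrix, `D` diagonal with entries
`±1`. -/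
def IsSignedPerm {r : ℕ} (A : Matrix (Fin r) (Fin r) ℝ) : Prop :=
  ∃ (σ : Equiv.Perm (Fin r)) (d : Fin r → ℝ), (∀ i, d i = 1 ∨ d i = -1) ∧
    A = Matrix.diagonal d * σ.permMatrix ℝ

/-- A permutation-and/or-sign-only invariant (PSOI) set. -/
def IsPSOI {r : ℕ} (S : Set (EuclideanSpace ℝ (Fin r))) : Prop :=
  ∀ A : Matrix (Fin r) (Fin r) ℝ, Matrix.toEuclideanLin A '' S = S → IsSignedPerm A

/-- Mutually PSOI sets `SW`, `SH`: no invertible `A` other than a signed permutation satisfies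
`A⁻ᵀ SW = SW` and `A SH = SH`. -/
def IsMutuallyPSOI {r : ℕ} (SW SH : Set (EuclideanSpace ℝ (Fin r))) : Prop :=
  ∀ A : Matrix (Fin r) (Fin r) ℝ, IsUnit A.det → Matrix.toEuclideanLin (A⁻¹)ᵀ '' SW = SW →
    Matrix.toEuclideanLin A '' SH = SH → IsSignedPerm A

end PMF

end

/-! Since `r = rank X`, any other factorization is `H' = A * H`, `W' = W * A⁻¹` with `A` invertible.
By [PMF.SSC1], `A` carries the MVIE of `PH` into `PH` and `(A⁻¹)ᵀ` carries that of `PW` into `PW`.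
Maximality of volume bounds both determinants by 1 in absolute value; their product is ±1, so both
have absolute value 1. The MVIE is unique (`eq_zero_and_norm_map_of_abs_det_eq_one`), so each map
preserves its MVIE and fixes the centre.

Now [PMF.SSC2] enters by duality: the adjoint sends the polar of the polytope into the polar of
`conv(H)` and preserves the boundary of the polar of the MVIE. It therefore permutes the finitely
many vertices of the polar of the polytope, and so the map itself preserves the polytope
(`image_eq_of_innerPolar_inter_frontier`) and permutes its vertices. The PSOI hypotheses finish.

A polytope need not be full-dimensional, so this takes place in the direction space `V` of its
affine hull. Because the polytope spans `ℝ^r` linearly, the map is the identity on `ℝ^r / V`, and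
restriction to `V` keeps the determinant (`det_restrict_direction`). -/

noncomputable section

namespace PMF

/-! ### Uniqueness of the maximal ellipsoid, normalized to a ball -/

section MaximalEllipsoid

variable {F : Type*} [NormedAddCommGroup F] [InnerProductSpace ℝ F]

theorem det_constr_smul {ι : Type*} [Fintype ι] [DecidableEq ι] (b : Module.Basis ι ℝ F)
    (t : ι → ℝ) : LinearMap.det (b.constr ℝ fun i => t i • b i) = ∏ i, t i := by
  rw [← LinearMap.det_toMatrix b, ← Matrix.det_diagonal]
  congr 1
  ext i j
  rw [LinearMap.toMatrix_apply, b.constr_basis, Matrix.diagonal_apply, map_smul]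
  by_cases h : i = j
  · simp [h]
  · simp [h, Finsupp.single_eq_of_ne h]

variable [FiniteDimensional ℝ F]

/-- Singular value decomposition of an automorphism. -/
theorem exists_orthonormalBasis_smul_isometry (M : F ≃ₗ[ℝ] F) :
    ∃ (b : OrthonormalBasis (Fin (Module.finrank ℝ F)) ℝ F) (U : F ≃ₗᵢ[ℝ] F)
      (s : Fin (Module.finrank ℝ F) → ℝ), (∀ i, 0 < s i) ∧ ∀ i, M (b i) = s i • U (b i) := by
  have hS : (LinearMap.adjoint M.toLinearMap ∘ₗ M.toLinearMap).IsSymmetric := fun x y => by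
    simp [LinearMap.adjoint_inner_left, LinearMap.adjoint_inner_right]
  -- `M` sends eigenvectors of its Gram operator to pairwise orthogonal vectors; normalizing them
  -- gives the second basis.
  let b := hS.eigenvectorBasis rfl
  have hM : ∀ i j, i ≠ j → ⟪M (b i), M (b j)⟫ = 0 := fun i j hij => by
    have h : ⟪(LinearMap.adjoint M.toLinearMap ∘ₗ M.toLinearMap) (b i), b j⟫ = 0 := by
      rw [hS.apply_eigenvectorBasis rfl i, real_inner_smul_left]
      exact mul_eq_zero_of_right _ (b.orthonormal.2 hij)
    simpa [LinearMap.adjoint_inner_left] using h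
  have hpos : ∀ i, 0 < ‖M (b i)‖ := fun i => norm_pos_iff.2 fun h =>
    b.orthonormal.ne_zero i (M.map_eq_zero_iff.1 h)
  have hu : Orthonormal ℝ fun i => ‖M (b i)‖⁻¹ • M (b i) := by
    refine ⟨fun i => ?_, fun i j hij => ?_⟩
    · rw [norm_smul, norm_inv, norm_norm, inv_mul_cancel₀ (hpos i).ne']
    · simp only [real_inner_smul_left, real_inner_smul_right, hM i j hij, mul_zero]
  let u := OrthonormalBasis.mk hu
    (hu.linearIndependent.span_eq_top_of_card_eq_finrank' (by simp)).ge
  refine ⟨b, b.equiv u (Equiv.refl _), fun i => ‖M (b i)‖, hpos, fun i => ?_⟩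
  simp [u, smul_smul, (hpos i).ne']

theorem abs_det_linearIsometryEquiv_comp (U : F ≃ₗᵢ[ℝ] F) (T : F →ₗ[ℝ] F) :
    |LinearMap.det (U.toLinearEquiv.toLinearMap ∘ₗ T)| = |LinearMap.det T| := by
  have h : |LinearMap.det U.toLinearEquiv.toLinearMap| = 1 := by
    rw [← LinearMap.normDet_eq_abs_det]
    exact U.toLinearIsometry.normDet_eq_one
  rw [LinearMap.det_comp, abs_mul, h, one_mul]

/-- AM–GM gives `s ≤ ((1 + s) / 2) ^ 2`, strictly unless `s = 1`; multiply over all indices. -/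
theorem prod_add_one_div_two_le {ι : Type*} [Fintype ι] {s : ι → ℝ} (hs : ∀ i, 0 < s i)
    (h1 : ∏ i, s i = 1) (h : ∏ i, (1 + s i) / 2 ≤ 1) : ∀ i, s i = 1 := by
  classical
  by_contra! hne
  obtain ⟨j, hj⟩ := hne
  have h2 : ∏ i, s i < ∏ i, ((1 + s i) / 2) ^ 2 := by
    refine Finset.prod_lt_prod (fun i _ => hs i) (fun i _ => ?_) ⟨j, Finset.mem_univ _, ?_⟩
    · nlinarith [sq_nonneg (1 - s i)]
    · have : 0 < (1 - s j) ^ 2 := by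
        have : 1 - s j ≠ 0 := fun h => hj (by linarith)
        positivity
      nlinarith
  rw [Finset.prod_pow, h1] at h2
  have h3 : 0 ≤ ∏ i, (1 + s i) / 2 := Finset.prod_nonneg fun i _ => by linarith [hs i]
  nlinarith

/-- If a ball centred at the origin has maximal volume among the ellipsoids in a convex set, then
so does no other ellipsoid. -/
theorem eq_zero_and_norm_map_of_abs_det_eq_one {P : Set F} (hP : Convex ℝ P) {ρ : ℝ} (hρ : 0 < ρ)
    (hball : ∀ x, ‖x‖ ≤ ρ → x ∈ P)
    (hmax : ∀ (T : F →ₗ[ℝ] F) (c : F), (∀ x, ‖x‖ ≤ ρ → c + T x ∈ P) → |LinearMap.det T| ≤ 1)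
    (M : F ≃ₗ[ℝ] F) (c : F) (hM : ∀ x, ‖x‖ ≤ ρ → c + M x ∈ P)
    (hdet : |LinearMap.det M.toLinearMap| = 1) : c = 0 ∧ ∀ x, ‖M x‖ = ‖x‖ := by
  obtain ⟨b, U, s, hs, hb⟩ := exists_orthonormalBasis_smul_isometry M
  have hMeq : M.toLinearMap =
      U.toLinearEquiv.toLinearMap ∘ₗ b.toBasis.constr ℝ fun i => s i • b.toBasis i :=
    b.toBasis.ext fun i => by simp [hb]
  have hprod : ∏ i, s i = 1 := by
    rw [hMeq, abs_det_linearIsometryEquiv_comp, det_constr_smul,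
      abs_of_pos (Finset.prod_pos fun i _ => hs i)] at hdet
    exact hdet
  -- The competitor is the midpoint of `U x` and `c + M x`, both in `P`; its linear part is `U`
  -- after scaling by `(1 + s i) / 2`.
  have hle : ∏ i, (1 + s i) / 2 ≤ 1 := by
    have h := hmax (U.toLinearEquiv.toLinearMap ∘ₗ
      b.toBasis.constr ℝ fun i => ((1 + s i) / 2) • b.toBasis i) ((1 / 2 : ℝ) • c) fun x hx => by
        have h1 : (U.toLinearEquiv.toLinearMap ∘ₗ
            b.toBasis.constr ℝ fun i => ((1 + s i) / 2) • b.toBasis i) =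
            (1 / 2 : ℝ) • (U.toLinearEquiv.toLinearMap + M.toLinearMap) :=
          b.toBasis.ext fun i => by
            simp only [LinearMap.comp_apply, Module.Basis.constr_basis]
            simp only [OrthonormalBasis.coe_toBasis, map_smul, LinearEquiv.coe_coe,
              LinearIsometryEquiv.coe_toLinearEquiv, LinearMap.smul_apply, LinearMap.add_apply, hb]
            module
        have h2 := hP (hball (U x) (by simpa using hx)) (hM x hx)
          (by norm_num : (0 : ℝ) ≤ 1 / 2) (by norm_num : (0 : ℝ) ≤ 1 / 2) (by norm_num)
        rw [h1]
        convert h2 using 1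
        simp only [LinearMap.smul_apply, LinearMap.add_apply, LinearEquiv.coe_coe,
          LinearIsometryEquiv.coe_toLinearEquiv]
        module
    rwa [abs_det_linearIsometryEquiv_comp, det_constr_smul,
      abs_of_nonneg (Finset.prod_nonneg fun i _ => by linarith [hs i])] at h
  have hs1 := prod_add_one_div_two_le hs hprod hle
  have hMU : ∀ x, M x = U x := fun x => by
    have : M.toLinearMap = U.toLinearEquiv.toLinearMap :=
      b.toBasis.ext fun i => by simp [hb, hs1]
    exact congrArg (fun f : F →ₗ[ℝ] F => f x) this
  refine ⟨?_, fun x => by rw [hMU, U.norm_map]⟩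
  by_contra hc
  have hc' : 0 < ‖c‖ := norm_pos_iff.2 hc
  -- This choice keeps the weights `1 / 2 ± ε * ⟪c, x⟫` nonnegative on the ball.
  let ε : ℝ := 1 / (2 * (ρ * ‖c‖))
  have hε : 0 < ε := by positivity
  -- `P` contains the ball and its translate by `c`. Weighting `x` and `c + x` by these weights
  -- stretches the ball along `c`, with determinant `1 + ε * ‖c‖ ^ 2 > 1`.
  have h := hmax (LinearMap.transvection (ε • innerₗ F c) c) ((1 / 2 : ℝ) • c)
    fun x hx => by
      have hin : |ε * ⟪c, x⟫| ≤ 1 / 2 := by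
        rw [abs_mul, abs_of_pos hε]
        have h1 : |⟪c, x⟫| ≤ ‖c‖ * ρ :=
          (abs_real_inner_le_norm c x).trans (by gcongr)
        calc ε * |⟪c, x⟫| ≤ ε * (‖c‖ * ρ) := by gcongr
          _ = 1 / 2 := by simp only [ε]; field_simp
      obtain ⟨h1, h2⟩ := abs_le.1 hin
      have h3 : c + x ∈ P := by
        have := hM (M.symm x) (by
          rw [← U.norm_map, ← hMU, M.apply_symm_apply]; exact hx)
        rwa [M.apply_symm_apply] at this
      have h4 := hP (hball x hx) h3 (by linarith : 0 ≤ 1 / 2 - ε * ⟪c, x⟫)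
        (by linarith : 0 ≤ 1 / 2 + ε * ⟪c, x⟫) (by ring)
      convert h4 using 1
      simp only [LinearMap.transvection.apply, LinearMap.smul_apply, innerₗ_apply_apply,
        smul_eq_mul]
      module
  rw [LinearMap.transvection.det, LinearMap.smul_apply, innerₗ_apply_apply,
    real_inner_self_eq_norm_sq, smul_eq_mul, abs_of_pos (by positivity)] at h
  have : 0 < ε * ‖c‖ ^ 2 := by positivity
  linarith

end MaximalEllipsoid

/-! ### Polars, and automorphisms recovered from the vertices of a polar -/

section InnerPolar

open scoped Topology

variable {F : Type*} [NormedAddCommGroup F] [InnerProductSpace ℝ F]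

/-- The polar of a set with respect to the origin. -/
def innerPolar (S : Set F) : Set F :=
  {x | ∀ y ∈ S, ⟪x, y⟫ ≤ 1}

theorem innerPolar_anti {S T : Set F} (h : S ⊆ T) : innerPolar T ⊆ innerPolar S :=
  fun _ hx y hy => hx y (h hy)

theorem convex_innerPolar (S : Set F) : Convex ℝ (innerPolar S) := by
  intro x hx y hy a b ha hb hab z hz
  rw [inner_add_left, real_inner_smul_left, real_inner_smul_left]
  nlinarith [hx z hz, hy z hz]

theorem isClosed_innerPolar (S : Set F) : IsClosed (innerPolar S) := by
  have : innerPolar S = ⋂ y ∈ S, {x | ⟪x, y⟫ ≤ 1} := by ext; simp [innerPolar]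
  rw [this]
  exact isClosed_biInter fun y _ => isClosed_le (by fun_prop) continuous_const

theorem innerPolar_convexHull (S : Set F) : innerPolar (convexHull ℝ S) = innerPolar S := by
  refine (innerPolar_anti (subset_convexHull ℝ S)).antisymm fun x hx y hy => ?_
  exact convexHull_min (t := {y | ⟪x, y⟫ ≤ 1}) hx
    (convex_halfSpace_le (innerₗ F x).isLinear 1) hy

theorem isCompact_innerPolar [FiniteDimensional ℝ F] {S : Set F} (hS : S ∈ 𝓝 0) :
    IsCompact (innerPolar S) := by
  obtain ⟨δ, hδ, hball⟩ := Metric.nhds_basis_closedBall.mem_iff.1 hS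
  refine Metric.isCompact_of_isClosed_isBounded (isClosed_innerPolar S)
    (isBounded_iff_forall_norm_le.2 ⟨δ⁻¹, fun x hx => ?_⟩)
  rcases eq_or_ne x 0 with rfl | h0
  · simpa using hδ.le
  have hx0 : 0 < ‖x‖ := norm_pos_iff.2 h0
  have h := hx ((δ * ‖x‖⁻¹) • x) (hball (by
    rw [mem_closedBall_zero_iff, norm_smul, norm_mul, norm_inv, norm_norm, mul_assoc,
      inv_mul_cancel₀ hx0.ne', mul_one, Real.norm_of_nonneg hδ.le]))
  rw [real_inner_smul_right, real_inner_self_eq_norm_sq] at h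
  rw [le_inv_comm₀ hx0 hδ, inv_eq_one_div, le_div_iff₀ hx0]
  calc δ * ‖x‖ = δ * ‖x‖⁻¹ * ‖x‖ ^ 2 := by field_simp
    _ ≤ 1 := h

/-- A polyhedron has finitely many extreme points. -/
theorem finite_extremePoints_innerPolar {V : Set F} (hV : V.Finite) :
    (Set.extremePoints ℝ (innerPolar V)).Finite := by
  -- An extreme point is determined by its set of active constraints, a subset of the finite set
  -- `V`.
  refine Set.Finite.of_finite_image (f := fun x => {y ∈ V | ⟪x, y⟫ = 1})
    (hV.powerset.subset ?_) ?_
  · rintro _ ⟨x, -, rfl⟩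
    exact Set.sep_subset _ _
  intro x hx x' hx' hxx'
  have hact : ∀ y ∈ V, ⟪x, y⟫ = 1 → ⟪x', y⟫ = 1 := fun y hy h =>
    ((Set.ext_iff.1 hxx' y).1 ⟨hy, h⟩).2
  -- The segment from `x'` can be prolonged slightly past `x`: active constraints stay equalities
  -- and the others have slack.
  have hev : ∀ᶠ ε : ℝ in 𝓝[>] 0, ∀ y ∈ V, ⟪x + ε • (x - x'), y⟫ ≤ 1 := by
    rw [Filter.eventually_all_finite hV]
    intro y hy
    by_cases h1 : ⟪x, y⟫ = 1
    · refine Filter.Eventually.of_forall fun ε => ?_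
      rw [inner_add_left, real_inner_smul_left, inner_sub_left, h1, hact y hy h1]
      simp
    · have hlt : ⟪x + (0 : ℝ) • (x - x'), y⟫ < 1 := by
        rw [zero_smul, add_zero]
        exact lt_of_le_of_ne (hx.1 y hy) h1
      have hc : Continuous fun ε : ℝ => ⟪x + ε • (x - x'), y⟫ := by fun_prop
      exact ((hc.tendsto 0).eventually_lt_const hlt).filter_mono nhdsWithin_le_nhds
        |>.mono fun _ => le_of_lt
  obtain ⟨ε, hε, hpos⟩ := (hev.and self_mem_nhdsWithin).exists
  have hpos : 0 < ε := hpos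
  have hseg : x ∈ openSegment ℝ x' (x + ε • (x - x')) := by
    refine ⟨ε / (1 + ε), 1 / (1 + ε), by positivity, by positivity, by field_simp; ring, ?_⟩
    have h : (1 + ε) ≠ 0 := by positivity
    rw [div_eq_inv_mul, div_eq_inv_mul, mul_smul, mul_smul, ← smul_add, inv_smul_eq_iff₀ h]
    module
  exact (hx.2 hx'.1 hε hseg).symm

variable [FiniteDimensional ℝ F]

/-- Hahn–Banach gives a point of the polar separating `z` from `P`; by Krein–Milman on the compact
polar, some extreme point must separate too. -/
theorem exists_extremePoint_innerPolar_one_lt {P : Set F} (hP : Convex ℝ P) (hcl : IsClosed P)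
    (h0 : P ∈ 𝓝 0) {z : F} (hz : z ∉ P) :
    ∃ e ∈ Set.extremePoints ℝ (innerPolar P), 1 < ⟪e, z⟫ := by
  by_contra! hall
  obtain ⟨f, u, hfu, hu⟩ := geometric_hahn_banach_closed_point hP hcl hz
  have hu0 : 0 < u := by simpa using hfu 0 (mem_of_mem_nhds h0)
  let w := (InnerProductSpace.toDual ℝ F).symm f
  have hw : ∀ y, ⟪w, y⟫ = f y := fun y => InnerProductSpace.toDual_symm_apply
  have hmem : u⁻¹ • w ∈ innerPolar P := fun y hy => by
    rw [real_inner_smul_left, hw, inv_mul_le_iff₀ hu0, mul_one]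
    exact (hfu y hy).le
  have hsub : innerPolar P ⊆ {x | ⟪x, z⟫ ≤ 1} := by
    rw [← closure_convexHull_extremePoints (isCompact_innerPolar h0) (convex_innerPolar P)]
    refine closure_minimal (convexHull_min hall ?_) (isClosed_le (by fun_prop) continuous_const)
    simp_rw [real_inner_comm z]
    exact convex_halfSpace_le (innerₗ F z).isLinear 1
  have h := hsub hmem
  rw [Set.mem_ofPred_eq, real_inner_smul_left, hw, inv_mul_le_iff₀ hu0, mul_one] at h
  linarith

/-- An automorphism that preserves an ellipsoid `E` and maps `C`, where `E ⊆ C ⊆ P`, into the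
polytope `P` preserves `P`, if the polars of `C` and `E` touch in the vertices of that of `P`. -/
theorem image_eq_of_innerPolar_inter_frontier {V P C E : Set F} (hV : V.Finite)
    (hPV : P = convexHull ℝ V) (hEC : E ⊆ C) (hCP : C ⊆ P) (hE : E ∈ 𝓝 0) (A : F ≃ₗ[ℝ] F)
    (hAC : ∀ x ∈ C, A x ∈ P) (hAE : A '' E = E)
    (h : innerPolar C ∩ intrinsicFrontier ℝ (innerPolar E) =
      Set.extremePoints ℝ (innerPolar P)) : A '' P = P := by
  have hinj : Function.Injective (LinearMap.adjoint A.toLinearMap) := by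
    rw [injective_iff_map_eq_zero]
    intro x hx
    have : ⟪LinearMap.adjoint A.toLinearMap x, A.symm x⟫ = ⟪x, x⟫ := by
      rw [LinearMap.adjoint_inner_left]
      simp
    rw [hx, inner_zero_left] at this
    exact inner_self_eq_zero.1 this.symm
  let B : F ≃ₗ[ℝ] F := LinearEquiv.ofInjectiveEndo _ hinj
  have hB : ∀ x y, ⟪B x, y⟫ = ⟪x, A y⟫ := fun x y => LinearMap.adjoint_inner_left _ _ _
  have hBE : B '' innerPolar E = innerPolar E := by
    have hiff : ∀ x, B x ∈ innerPolar E ↔ x ∈ innerPolar E := fun x => by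
      conv_rhs => rw [← hAE]
      simp [innerPolar, hB]
    ext x
    rw [← B.apply_symm_apply x, B.injective.mem_set_image, hiff]
  have hBfr : B '' intrinsicFrontier ℝ (innerPolar E) = intrinsicFrontier ℝ (innerPolar E) := by
    let B' : F ≃L[ℝ] F := B.toContinuousLinearEquiv
    have := B'.toContinuousAffineEquiv.intrinsicFrontier_image (innerPolar E)
    conv_rhs => rw [← hBE]
    exact this.symm
  have hBext : B '' Set.extremePoints ℝ (innerPolar P) ⊆ Set.extremePoints ℝ (innerPolar P) := by
    rintro _ ⟨e, he, rfl⟩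
    have he' := he
    rw [← h] at he ⊢
    refine ⟨fun y hy => ?_, hBfr ▸ Set.mem_image_of_mem B he.2⟩
    rw [hB]
    exact he'.1 _ (hAC y hy)
  have hfin : (Set.extremePoints ℝ (innerPolar P)).Finite := by
    rw [hPV, innerPolar_convexHull]
    exact finite_extremePoints_innerPolar hV
  -- An injective self-map of a finite set is onto; this is where polyhedrality of `P` is used.
  have hBeq := Set.eq_of_subset_of_ncard_le hBext (Set.ncard_image_of_injective _ B.injective).ge
    hfin
  have hconv : Convex ℝ P := hPV ▸ convex_convexHull ℝ V
  have hcl : IsClosed P := hPV ▸ hV.isClosed_convexHull ℝ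
  have h0 : P ∈ 𝓝 0 := Filter.mem_of_superset hE (hEC.trans hCP)
  apply Set.Subset.antisymm
  · rintro _ ⟨y, hy, rfl⟩
    by_contra hz
    obtain ⟨e, he, hlt⟩ := exists_extremePoint_innerPolar_one_lt hconv hcl h0 hz
    rw [← hB] at hlt
    exact absurd ((hBext ⟨e, he, rfl⟩).1 y hy) hlt.not_ge
  · intro y hy
    refine ⟨A.symm y, ?_, A.apply_symm_apply y⟩
    by_contra hz
    obtain ⟨e, he, hlt⟩ := exists_extremePoint_innerPolar_one_lt hconv hcl h0 hz
    rw [← hBeq] at he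
    obtain ⟨e', he', rfl⟩ := he
    rw [hB, A.apply_symm_apply] at hlt
    exact absurd (he'.1 y hy) hlt.not_ge

end InnerPolar

/-! ### Matrix ellipsoids as images of balls, and uniqueness of the MVIE -/

section Ellipsoid

variable {r : ℕ}

theorem dotProduct_conjTranspose_mul_self_mulVec (R : Matrix (Fin r) (Fin r) ℝ)
    (x : EuclideanSpace ℝ (Fin r)) :
    x.ofLp ⬝ᵥ ((Rᴴ * R) *ᵥ x.ofLp) = ‖Matrix.toEuclideanLin R x‖ ^ 2 := by
  rw [EuclideanSpace.real_norm_sq_eq, ← Matrix.mulVec_mulVec,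
    Matrix.conjTranspose_eq_transpose_of_trivial, Matrix.dotProduct_mulVec, Matrix.vecMul_transpose]
  simp [dotProduct, sq]

theorem exists_linearEquiv_quadraticForm_eq {E : Matrix (Fin r) (Fin r) ℝ} (hE : E.PosDef)
    (V : Submodule ℝ (EuclideanSpace ℝ (Fin r))) :
    ∃ T : V ≃ₗ[ℝ] V, ∀ v : V,
      (v : EuclideanSpace ℝ (Fin r)).ofLp ⬝ᵥ (E *ᵥ (v : EuclideanSpace ℝ (Fin r)).ofLp) =
        ‖T.symm v‖ ^ 2 := by
  open scoped MatrixOrder in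
  obtain ⟨R, hR⟩ := CStarAlgebra.nonneg_iff_eq_star_mul_self.mp hE.posSemidef.nonneg
  rw [Matrix.star_eq_conjTranspose] at hR
  let f : V →ₗ[ℝ] EuclideanSpace ℝ (Fin r) := Matrix.toEuclideanLin R ∘ₗ V.subtype
  have hf : ∀ v : V, (v : EuclideanSpace ℝ (Fin r)).ofLp ⬝ᵥ
      (E *ᵥ (v : EuclideanSpace ℝ (Fin r)).ofLp) = ‖f v‖ ^ 2 := fun v => by
    rw [hR, dotProduct_conjTranspose_mul_self_mulVec]
    rfl
  have hinj : Function.Injective f := by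
    rw [injective_iff_map_eq_zero]
    intro v hv
    by_contra h0
    have h1 := hE.dotProduct_mulVec_pos (x := (v : EuclideanSpace ℝ (Fin r)).ofLp)
      (by simpa using h0)
    rw [star_trivial, hf, hv] at h1
    simp at h1
  let e := LinearEquiv.ofInjective f hinj
  -- The range of `f` may differ from `V`; an isometry between these spaces of equal dimension
  -- brings it back without changing norms.
  let φ : LinearMap.range f ≃ₗᵢ[ℝ] V :=
    (stdOrthonormalBasis ℝ (LinearMap.range f)).equiv (stdOrthonormalBasis ℝ V)
      (finCongr (LinearMap.finrank_range_of_inj hinj))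
  refine ⟨(e.trans φ.toLinearEquiv).symm, fun v => ?_⟩
  rw [hf, LinearEquiv.symm_symm]
  simp [e]

theorem exists_posDef_quadraticForm_eq {V : Submodule ℝ (EuclideanSpace ℝ (Fin r))}
    (T : V ≃ₗ[ℝ] V) :
    ∃ E : Matrix (Fin r) (Fin r) ℝ, E.PosDef ∧ ∀ v : V,
      (v : EuclideanSpace ℝ (Fin r)).ofLp ⬝ᵥ (E *ᵥ (v : EuclideanSpace ℝ (Fin r)).ofLp) =
        ‖T.symm v‖ ^ 2 := by
  let p : EuclideanSpace ℝ (Fin r) →ₗ[ℝ] V := V.orthogonalProjectionOnto.toLinearMap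
  -- This is `T.symm` on `V` and the identity on its orthogonal complement, hence injective, so its
  -- Gram matrix is positive definite.
  let f : EuclideanSpace ℝ (Fin r) →ₗ[ℝ] EuclideanSpace ℝ (Fin r) :=
    V.subtype ∘ₗ T.symm.toLinearMap ∘ₗ p + (LinearMap.id - V.subtype ∘ₗ p)
  have hpV : ∀ v : V, p v = v := fun v => V.orthogonalProjectionOnto_mem_subspace_eq_self v
  have hfV : ∀ v : V, f v = T.symm v := fun v => by simp [f, hpV]
  have hinj : Function.Injective f := by
    rw [injective_iff_map_eq_zero]
    intro x hx
    have h1 : p x = 0 := by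
      have h2 : p (f x) = T.symm (p x) := by simp [f, hpV]
      rw [hx, map_zero] at h2
      exact T.symm.map_eq_zero_iff.1 h2.symm
    simpa [f, h1] using hx
  let R := Matrix.toEuclideanLin.symm f
  have hR : Matrix.toEuclideanLin R = f := LinearEquiv.apply_symm_apply _ _
  refine ⟨Rᴴ * R, Matrix.PosDef.conjTranspose_mul_self R fun x y hxy => ?_, fun v => ?_⟩
  · have h : f (WithLp.toLp 2 x) = f (WithLp.toLp 2 y) := by
      rw [← hR, Matrix.toLpLin_apply, Matrix.toLpLin_apply]
      exact congrArg _ hxy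
    exact (WithLp.toLp_injective 2) (hinj h)
  · rw [dotProduct_conjTranspose_mul_self_mulVec, hR, hfV, Submodule.coe_norm]

variable {L : AffineSubspace ℝ (EuclideanSpace ℝ (Fin r))}

theorem ellipsoidIn_eq_image {E : Matrix (Fin r) (Fin r) ℝ} {c : EuclideanSpace ℝ (Fin r)}
    (hc : c ∈ L) (T : L.direction ≃ₗ[ℝ] L.direction)
    (hT : ∀ v : L.direction, (v : EuclideanSpace ℝ (Fin r)).ofLp ⬝ᵥ
      (E *ᵥ (v : EuclideanSpace ℝ (Fin r)).ofLp) = ‖T.symm v‖ ^ 2) :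
    ellipsoidIn L E c = (fun v : L.direction => c + (v : EuclideanSpace ℝ (Fin r))) ''
      (T.toLinearMap '' Metric.closedBall 0 √r) := by
  ext x
  simp only [ellipsoidIn, Set.mem_ofPred_eq, Set.mem_image, exists_exists_and_eq_and,
    mem_closedBall_zero_iff]
  constructor
  · rintro ⟨hx, h⟩
    have hv : x - c ∈ L.direction := L.vsub_mem_direction hx hc
    refine ⟨T.symm ⟨x - c, hv⟩, ?_, by simp⟩
    rw [hT ⟨x - c, hv⟩] at h
    exact Real.le_sqrt_of_sq_le h
  · rintro ⟨v, hv, rfl⟩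
    refine ⟨?_, ?_⟩
    · rw [add_comm]
      exact AffineSubspace.vadd_mem_of_mem_direction (T v).2 hc
    · rw [add_sub_cancel_left]
      simp only [LinearEquiv.coe_coe]
      rw [hT, T.symm_apply_apply]
      exact (Real.le_sqrt (norm_nonneg _) (Nat.cast_nonneg _)).1 hv

theorem volIn_image (c : EuclideanSpace ℝ (Fin r)) (T : L.direction →ₗ[ℝ] L.direction)
    (S : Set L.direction) :
    volIn L ((fun v : L.direction => c + (v : EuclideanSpace ℝ (Fin r))) '' (T '' S)) =
      ENNReal.ofReal |LinearMap.det T| * MeasureTheory.volume S := by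
  have hiso : Isometry fun v : L.direction => c + (v : EuclideanSpace ℝ (Fin r)) :=
    (isometry_add_left c).comp isometry_subtype_coe
  rw [volIn, hiso.euclideanHausdorffMeasure_image,
    T.euclideanHausdorffMeasure_image_eq_normDet_mul_volume, LinearMap.normDet_eq_abs_det]

/-- The ellipsoid `g + T (ball)` is inscribed in `P` and no other one is larger. -/
structure IsMaximalEllipsoid (P : Set (EuclideanSpace ℝ (Fin r)))
    (T : (affineSpan ℝ P).direction ≃ₗ[ℝ] (affineSpan ℝ P).direction)
    (g : EuclideanSpace ℝ (Fin r)) : Prop where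
  center_mem : g ∈ affineSpan ℝ P
  subset : ∀ v, ‖v‖ ≤ √r → g + (T v : EuclideanSpace ℝ (Fin r)) ∈ P
  max_det : ∀ (T' : (affineSpan ℝ P).direction →ₗ[ℝ] (affineSpan ℝ P).direction),
    ∀ c ∈ affineSpan ℝ P, (∀ v, ‖v‖ ≤ √r → c + (T' v : EuclideanSpace ℝ (Fin r)) ∈ P) →
      |LinearMap.det T'| ≤ |LinearMap.det T.toLinearMap|

theorem IsMVIE.exists_isMaximalEllipsoid (hr : 0 < r) {P : Set (EuclideanSpace ℝ (Fin r))}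
    {E : Matrix (Fin r) (Fin r) ℝ} {g : EuclideanSpace ℝ (Fin r)} (h : IsMVIE P E g) :
    ∃ T, IsMaximalEllipsoid P T g ∧ ellipsoidIn (affineSpan ℝ P) E g =
      (fun v : (affineSpan ℝ P).direction => g + (v : EuclideanSpace ℝ (Fin r))) ''
        (T.toLinearMap '' Metric.closedBall 0 √r) := by
  obtain ⟨T, hT⟩ :=
    exists_linearEquiv_quadraticForm_eq h.inscribed.posDef (affineSpan ℝ P).direction
  have hell := ellipsoidIn_eq_image h.inscribed.center_mem T hT
  refine ⟨T, ⟨h.inscribed.center_mem, fun v hv => h.inscribed.subset ?_, fun T' c hc hT' => ?_⟩,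
    hell⟩
  · rw [hell]
    exact ⟨_, ⟨v, by simpa using hv, rfl⟩, rfl⟩
  -- A singular `T'` is not given by a positive definite matrix, but the bound is then trivial.
  by_cases hdet : LinearMap.det T' = 0
  · rw [hdet, abs_zero]
    exact abs_nonneg _
  obtain ⟨E', hE', hform⟩ := exists_posDef_quadraticForm_eq (LinearMap.equivOfDetNeZero T' hdet)
  have hell' := ellipsoidIn_eq_image hc _ hform
  have hle := h.max_vol E' c ⟨hE', hc, by
    rw [hell']
    rintro _ ⟨_, ⟨v, hv, rfl⟩, rfl⟩
    exact hT' v (by simpa using hv)⟩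
  have hpos : 0 < √(r : ℝ) := Real.sqrt_pos.2 (Nat.cast_pos.2 hr)
  rw [hell, hell', volIn_image, volIn_image, ENNReal.mul_le_mul_iff_left
    (Metric.measure_closedBall_pos _ _ hpos).ne' MeasureTheory.measure_closedBall_lt_top.ne,
    ENNReal.ofReal_le_ofReal_iff (abs_nonneg _)] at hle
  exact hle

/-- In the coordinates `v ↦ g + T v` the maximal ellipsoid becomes a ball, and the ball case applies
to `T'` followed by `T.symm`. -/
theorem IsMaximalEllipsoid.eq_and_norm_eq (hr : 0 < r) {P : Set (EuclideanSpace ℝ (Fin r))}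
    (hP : Convex ℝ P) {T T' : (affineSpan ℝ P).direction ≃ₗ[ℝ] (affineSpan ℝ P).direction}
    {g g' : EuclideanSpace ℝ (Fin r)} (h : IsMaximalEllipsoid P T g) (hg' : g' ∈ affineSpan ℝ P)
    (hsub : ∀ v, ‖v‖ ≤ √r → g' + (T' v : EuclideanSpace ℝ (Fin r)) ∈ P)
    (hdet : |LinearMap.det T'.toLinearMap| = |LinearMap.det T.toLinearMap|) :
    g' = g ∧ ∀ v, ‖T.symm (T' v)‖ = ‖v‖ := by
  have hpos : 0 < √(r : ℝ) := Real.sqrt_pos.2 (Nat.cast_pos.2 hr)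
  have hTdet : 0 < |LinearMap.det T.toLinearMap| := abs_pos.2 T.isUnit_det'.ne_zero
  have hmem : g' - g ∈ (affineSpan ℝ P).direction :=
    AffineSubspace.vsub_mem_direction hg' h.center_mem
  let j : (affineSpan ℝ P).direction →ₗ[ℝ] EuclideanSpace ℝ (Fin r) :=
    (affineSpan ℝ P).direction.subtype ∘ₗ T.toLinearMap
  have hconv : Convex ℝ {v | g + j v ∈ P} :=
    (hP.translate_preimage_right g).linear_preimage j
  have := eq_zero_and_norm_map_of_abs_det_eq_one hconv hpos h.subset (fun S c hS => by
    have hle := h.max_det (T.toLinearMap ∘ₗ S) (g + T c) (by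
      rw [add_comm]
      exact AffineSubspace.vadd_mem_of_mem_direction (T c).2 h.center_mem) fun v hv => by
        have := hS v hv
        simpa [j, add_assoc] using this
    rw [LinearMap.det_comp, abs_mul] at hle
    nlinarith) (T'.trans T.symm) (T.symm ⟨g' - g, hmem⟩) (fun v hv => by
      have := hsub v hv
      simpa [j, ← add_assoc] using this) (by
      have h1 : T.toLinearMap ∘ₗ (T'.trans T.symm).toLinearMap = T'.toLinearMap := by
        ext; simp
      rw [← h1, LinearMap.det_comp, abs_mul] at hdet
      nlinarith)
  refine ⟨?_, this.2⟩
  have h0 := T.symm.map_eq_zero_iff.1 this.1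
  exact sub_eq_zero.1 (congrArg Subtype.val h0)

/-- Needed because `SSC1` and `SSC2` each quantify over their own MVIE. -/
theorem IsMVIE.unique (hr : 0 < r) {P : Set (EuclideanSpace ℝ (Fin r))} (hP : Convex ℝ P)
    {E E' : Matrix (Fin r) (Fin r) ℝ} {g g' : EuclideanSpace ℝ (Fin r)} (h : IsMVIE P E g)
    (h' : IsMVIE P E' g') :
    g' = g ∧ ellipsoidIn (affineSpan ℝ P) E' g' ⊆ ellipsoidIn (affineSpan ℝ P) E g := by
  obtain ⟨T, hT, hell⟩ := h.exists_isMaximalEllipsoid hr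
  obtain ⟨T', hT', hell'⟩ := h'.exists_isMaximalEllipsoid hr
  obtain ⟨rfl, hnorm⟩ := hT.eq_and_norm_eq hr hP hT'.center_mem hT'.subset
    ((hT.max_det _ _ hT'.center_mem hT'.subset).antisymm
      (hT'.max_det _ _ hT.center_mem hT.subset))
  refine ⟨rfl, ?_⟩
  rw [hell, hell']
  refine Set.image_mono ?_
  rintro _ ⟨v, hv, rfl⟩
  exact ⟨T.symm (T' v), by simpa [hnorm] using hv, by simp⟩

end Ellipsoid

/-! ### Linear maps sending the MVIE into the polytope -/

section Automorphism

open scoped Topology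

variable {r : ℕ} {P : Set (EuclideanSpace ℝ (Fin r))}
  {T : (affineSpan ℝ P).direction ≃ₗ[ℝ] (affineSpan ℝ P).direction}
  {g : EuclideanSpace ℝ (Fin r)}

theorem sub_mem_direction {x : EuclideanSpace ℝ (Fin r)} (hx : x ∈ affineSpan ℝ P)
    (hg : g ∈ affineSpan ℝ P) : x - g ∈ (affineSpan ℝ P).direction :=
  AffineSubspace.vsub_mem_direction hx hg

theorem map_mem_affineSpan_of_ellipsoid (hr : 0 < r)
    (a : EuclideanSpace ℝ (Fin r) →ₗ[ℝ] EuclideanSpace ℝ (Fin r))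
    (ha : ∀ v, ‖v‖ ≤ √r → a (g + T v) ∈ P) :
    a g ∈ affineSpan ℝ P ∧
      (affineSpan ℝ P).direction ≤ (affineSpan ℝ P).direction.comap a := by
  have hpos : 0 < √(r : ℝ) := Real.sqrt_pos.2 (Nat.cast_pos.2 hr)
  have hag : a g ∈ affineSpan ℝ P := by
    have := ha 0 (by simp)
    rw [map_zero, ZeroMemClass.coe_zero, add_zero] at this
    exact subset_affineSpan ℝ P this
  refine ⟨hag, fun v hv => ?_⟩
  rw [Submodule.mem_comap]
  let w := T.symm ⟨v, hv⟩
  -- Every direction vector can be scaled into the ellipsoid, whose image lies in `P`.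
  have hle : ‖(√r / (1 + ‖w‖)) • w‖ ≤ √r := by
    rw [norm_smul, Real.norm_of_nonneg (by positivity), div_mul_eq_mul_div,
      div_le_iff₀ (by positivity)]
    nlinarith [norm_nonneg w]
  have hmem := sub_mem_direction (subset_affineSpan ℝ P (ha _ hle)) hag
  rw [map_add, add_sub_cancel_left, map_smul, SetLike.val_smul, map_smul,
    Submodule.smul_mem_iff _ (by positivity)] at hmem
  simpa [w] using hmem

/-- For `p ∈ P`, both `p` and `a p` lie in the affine hull, so `a p - p` is a direction vector. As
`P` spans, `a` induces the identity on the quotient, which contributes determinant 1. -/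
theorem det_restrict_direction (hspan : Submodule.span ℝ P = ⊤) (hg : g ∈ affineSpan ℝ P)
    {a : EuclideanSpace ℝ (Fin r) →ₗ[ℝ] EuclideanSpace ℝ (Fin r)} (hag : a g ∈ affineSpan ℝ P)
    (haV : (affineSpan ℝ P).direction ≤ (affineSpan ℝ P).direction.comap a) :
    LinearMap.det (a.restrict haV) = LinearMap.det a := by
  have hsub : ∀ x, a x - x ∈ (affineSpan ℝ P).direction := fun x => by
    have hx : x ∈ Submodule.span ℝ P := hspan ▸ Submodule.mem_top
    induction hx using Submodule.span_induction with
    | mem p hp =>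
      have hp := subset_affineSpan ℝ P hp
      have h1 := haV (sub_mem_direction hp hg)
      rw [Submodule.mem_comap, map_sub] at h1
      have h2 := add_mem (add_mem h1 (sub_mem_direction hag hg)) (sub_mem_direction hg hp)
      convert h2 using 1
      abel
    | zero => simp
    | add x y _ _ hx hy =>
      convert add_mem hx hy using 1
      rw [map_add]
      abel
    | smul t x _ hx =>
      rw [map_smul, ← smul_sub]
      exact Submodule.smul_mem _ _ hx
  have hQ : (affineSpan ℝ P).direction.mapQ (affineSpan ℝ P).direction a haV = LinearMap.id := by
    refine Submodule.linearMap_qext _ (LinearMap.ext fun x => ?_)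
    exact (Submodule.Quotient.eq _).2 (hsub x)
  rw [LinearMap.det_eq_det_mul_det _ a haV, hQ, LinearMap.det_id, mul_one]

theorem IsMaximalEllipsoid.abs_det_le_one (hr : 0 < r) (hspan : Submodule.span ℝ P = ⊤)
    (h : IsMaximalEllipsoid P T g)
    (a : EuclideanSpace ℝ (Fin r) →ₗ[ℝ] EuclideanSpace ℝ (Fin r))
    (ha : ∀ v, ‖v‖ ≤ √r → a (g + T v) ∈ P) : |LinearMap.det a| ≤ 1 := by
  obtain ⟨hag, haV⟩ := map_mem_affineSpan_of_ellipsoid hr a ha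
  have hle := h.max_det (a.restrict haV ∘ₗ T.toLinearMap) (a g) hag fun v hv => by
    have := ha v hv
    rwa [map_add] at this
  rw [LinearMap.det_comp, abs_mul, det_restrict_direction hspan h.center_mem hag] at hle
  have hT : 0 < |LinearMap.det T.toLinearMap| := abs_pos.2 T.isUnit_det'.ne_zero
  nlinarith

theorem polarIn_eq_image (hg : g ∈ affineSpan ℝ P) {S : Set (EuclideanSpace ℝ (Fin r))}
    (hS : S ⊆ affineSpan ℝ P) :
    polarIn (affineSpan ℝ P).direction g S =
      Subtype.val '' innerPolar {v : (affineSpan ℝ P).direction | g + v ∈ S} := by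
  ext x
  constructor
  · rintro ⟨hx, h⟩
    refine ⟨⟨x, hx⟩, fun v hv => ?_, rfl⟩
    have := h _ hv
    rwa [add_sub_cancel_left] at this
  · rintro ⟨x, hx, rfl⟩
    exact ⟨x.2, fun y hy => hx ⟨y - g, sub_mem_direction (hS hy) hg⟩ (by simpa using hy)⟩

theorem extremePoints_image_subtype {E : Type*} [AddCommGroup E] [Module ℝ E]
    (V : Submodule ℝ E) (S : Set V) :
    Set.extremePoints ℝ (Subtype.val '' S) = Subtype.val '' Set.extremePoints ℝ S := by
  have hseg : ∀ x y : V, openSegment ℝ (x : E) y = Subtype.val '' openSegment ℝ x y := fun x y =>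
    (image_openSegment ℝ V.subtype.toAffineMap x y).symm
  ext x
  constructor
  · rintro ⟨⟨x, hx, rfl⟩, h⟩
    refine ⟨x, ⟨hx, fun y hy z hz hyz => Subtype.ext (h ⟨y, hy, rfl⟩ ⟨z, hz, rfl⟩ ?_)⟩, rfl⟩
    rw [hseg]
    exact ⟨x, hyz, rfl⟩
  · rintro ⟨x, ⟨hx, h⟩, rfl⟩
    refine ⟨⟨x, hx, rfl⟩, ?_⟩
    rintro _ ⟨y, hy, rfl⟩ _ ⟨z, hz, rfl⟩ hyz
    rw [hseg, Subtype.val_injective.mem_set_image] at hyz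
    rw [h hy hz hyz]

theorem intrinsicFrontier_image_subtype (V : Submodule ℝ (EuclideanSpace ℝ (Fin r)))
    (S : Set V) : intrinsicFrontier ℝ (Subtype.val '' S : Set (EuclideanSpace ℝ (Fin r))) =
      Subtype.val '' intrinsicFrontier ℝ S :=
  V.subtypeₗᵢ.toAffineIsometry.intrinsicFrontier_image S

theorem exists_finite_translate_eq_convexHull (hP : IsPolytope P) (hg : g ∈ affineSpan ℝ P) :
    ∃ V : Set (affineSpan ℝ P).direction, V.Finite ∧
      {v : (affineSpan ℝ P).direction | g + v ∈ P} = convexHull ℝ V := by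
  obtain ⟨K, hK⟩ := hP
  let j : (affineSpan ℝ P).direction →ᵃ[ℝ] EuclideanSpace ℝ (Fin r) :=
    AffineMap.const ℝ _ g + (affineSpan ℝ P).direction.subtype.toAffineMap
  have hj : ∀ v, j v = g + v := fun v => by simp [j]
  have hinj : Function.Injective j := fun v w h => by
    rw [hj, hj] at h
    exact Subtype.ext (add_left_cancel h)
  have himg : ∀ S ⊆ P, j '' (j ⁻¹' S) = S := fun S hS => by
    refine Set.image_preimage_eq_of_subset fun x hx => ?_
    exact ⟨⟨x - g, sub_mem_direction (subset_affineSpan ℝ P (hS hx)) hg⟩, by simp [hj]⟩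
  refine ⟨j ⁻¹' K, K.finite_toSet.preimage hinj.injOn, hinj.image_injective ?_⟩
  rw [AffineMap.image_convexHull, himg _ (hK ▸ subset_convexHull ℝ _), ← hK]
  have : {v : (affineSpan ℝ P).direction | g + v ∈ P} = j ⁻¹' P := by ext; simp [hj]
  rw [this, himg P subset_rfl]

/-- Uniqueness of the MVIE makes `a` fix `g`, so in the coordinates `x - g` it acts linearly on the
direction space and the polar argument applies there. -/
theorem image_extremePoints_eq_of_SSC2 {n : ℕ} (hr : 0 < r) (hP : IsPolytope P)
    (hspan : Submodule.span ℝ P = ⊤) {H : Matrix (Fin r) (Fin n) ℝ} (h1 : SSC1 P H)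
    (h2 : SSC2 P H) (a : EuclideanSpace ℝ (Fin r) ≃ₗ[ℝ] EuclideanSpace ℝ (Fin r))
    (ha : ∀ x ∈ convCols H, a x ∈ P) (hdet : |LinearMap.det a.toLinearMap| = 1) :
    a '' Set.extremePoints ℝ P = Set.extremePoints ℝ P := by
  have hconv : Convex ℝ P := by
    obtain ⟨K, rfl⟩ := hP
    exact convex_convexHull ℝ _
  obtain ⟨hHP, E₁, g₁, hM₁, hsub₁⟩ := h1
  obtain ⟨E, g, hM, h2⟩ := h2
  have hEH := (hM₁.unique hr hconv hM).2.trans hsub₁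
  obtain ⟨T, hT, hell⟩ := hM.exists_isMaximalEllipsoid hr
  rw [hell] at hEH
  have haT : ∀ v, ‖v‖ ≤ √r → a (g + T v) ∈ P := fun v hv =>
    ha _ (hEH ⟨_, ⟨v, by simpa using hv, rfl⟩, rfl⟩)
  obtain ⟨hag, haV⟩ := map_mem_affineSpan_of_ellipsoid hr a.toLinearMap haT
  have hdetV := det_restrict_direction hspan hT.center_mem hag haV
  let b := LinearMap.equivOfDetNeZero (a.toLinearMap.restrict haV) (by
    rw [hdetV]
    exact a.isUnit_det'.ne_zero)
  have hb : ∀ v, (b v : EuclideanSpace ℝ (Fin r)) = a v := fun v => rfl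
  obtain ⟨hfix, hnorm⟩ := hT.eq_and_norm_eq (T' := T.trans b) hr hconv hag (fun v hv => by
    have := haT v hv
    rw [map_add] at this
    exact this) (by
    change |LinearMap.det (a.toLinearMap.restrict haV ∘ₗ T.toLinearMap)| = _
    rw [LinearMap.det_comp, abs_mul, hdetV, hdet, one_mul])
  have hfix : a g = g := hfix
  have hsurj : ∀ v, ‖T.symm (b.symm (T v))‖ = ‖v‖ := fun v => by
    rw [← hnorm]
    simp
  let P₀ := {v : (affineSpan ℝ P).direction | g + v ∈ P}
  let C₀ := {v : (affineSpan ℝ P).direction | g + v ∈ convCols H}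
  let E₀ := T.toLinearMap '' Metric.closedBall 0 √r
  have hEell : {v : (affineSpan ℝ P).direction |
      g + (v : EuclideanSpace ℝ (Fin r)) ∈ ellipsoidIn (affineSpan ℝ P) E g} = E₀ := by
    rw [hell]
    refine Set.preimage_image_eq _ fun v w h => Subtype.ext (add_left_cancel h)
  have hE₀ : E₀ ∈ 𝓝 0 := by
    let T' : (affineSpan ℝ P).direction ≃L[ℝ] (affineSpan ℝ P).direction :=
      T.toContinuousLinearEquiv
    have hball : Metric.closedBall (0 : (affineSpan ℝ P).direction) √r ∈ 𝓝 0 :=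
      Metric.closedBall_mem_nhds _ (Real.sqrt_pos.2 (Nat.cast_pos.2 hr))
    have := T'.toHomeomorph.isOpenMap.image_mem_nhds hball
    have h0 : T'.toHomeomorph 0 = 0 := map_zero T
    rw [h0] at this
    exact this
  have hbE : b '' E₀ = E₀ := by
    apply Set.Subset.antisymm
    · rintro _ ⟨_, ⟨v, hv, rfl⟩, rfl⟩
      rw [mem_closedBall_zero_iff] at hv
      refine ⟨T.symm (b (T v)), ?_, by simp⟩
      rw [mem_closedBall_zero_iff]
      exact (hnorm v).trans_le hv
    · rintro _ ⟨v, hv, rfl⟩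
      rw [mem_closedBall_zero_iff] at hv
      refine ⟨b.symm (T v), ⟨T.symm (b.symm (T v)), ?_, by simp⟩, by simp⟩
      rw [mem_closedBall_zero_iff, hsurj]
      exact hv
  have hpolar : innerPolar C₀ ∩ intrinsicFrontier ℝ (innerPolar E₀) =
      Set.extremePoints ℝ (innerPolar P₀) := by
    rw [polarIn_eq_image hT.center_mem (hHP.trans (subset_affineSpan ℝ P)),
      polarIn_eq_image hT.center_mem fun x hx => hx.1,
      polarIn_eq_image hT.center_mem (subset_affineSpan ℝ P), hEell,
      intrinsicFrontier_image_subtype, extremePoints_image_subtype,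
      ← Set.image_inter Subtype.val_injective] at h2
    exact Subtype.val_injective.image_injective h2
  obtain ⟨V, hV, hPV⟩ := exists_finite_translate_eq_convexHull hP hT.center_mem
  have hbP : b '' P₀ = P₀ := image_eq_of_innerPolar_inter_frontier (C := C₀) (E := E₀) hV hPV
    (fun v hv => hEH ⟨v, hv, rfl⟩) (fun v hv => hHP hv) hE₀ b (fun v hv => by
      have := ha _ hv
      rw [map_add, hfix] at this
      exact this) hbE hpolar
  have haP : a '' P = P := by
    apply Set.Subset.antisymm
    · rintro _ ⟨x, hx, rfl⟩
      have hx' : (⟨x - g, sub_mem_direction (subset_affineSpan ℝ P hx) hT.center_mem⟩ :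
          (affineSpan ℝ P).direction) ∈ P₀ := by
        simpa [P₀] using hx
      have hmem : g + a (x - g) ∈ P := hbP.subset ⟨_, hx', rfl⟩
      rwa [map_sub, hfix, add_sub_cancel] at hmem
    · intro x hx
      have hx' : (⟨x - g, sub_mem_direction (subset_affineSpan ℝ P hx) hT.center_mem⟩ :
          (affineSpan ℝ P).direction) ∈ P₀ := by
        simpa [P₀] using hx
      obtain ⟨v, hv, hvx⟩ := hbP.superset hx'
      refine ⟨g + v, hv, ?_⟩
      rw [map_add, hfix, ← hb, hvx]
      simp
  rw [image_extremePoints, haP]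

end Automorphism

/-! ### Minimal factorizations and the reduction to signed permutations -/

section Factorization

variable {m n r : ℕ}

theorem exists_mul_eq_one_of_rank_eq {W : Matrix (Fin m) (Fin r) ℝ} (hW : W.rank = r) :
    ∃ L : Matrix (Fin r) (Fin m) ℝ, L * W = 1 := by
  have h : (Wᵀ * W).rank = Fintype.card (Fin r) := by
    rw [Matrix.rank_transpose_mul_self, hW, Fintype.card_fin]
  have hu : IsUnit (Wᵀ * W).det := by
    rw [← Matrix.isUnit_iff_isUnit_det]
    rw [← Matrix.linearIndependent_cols_iff_isUnit, linearIndependent_iff_card_eq_finrank_span,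
      ← h, Matrix.rank_eq_finrank_span_cols]
    rfl
  exact ⟨(Wᵀ * W)⁻¹ * Wᵀ, by rw [Matrix.mul_assoc, Matrix.nonsing_inv_mul _ hu]⟩

/-- Two minimal factorizations of a matrix differ by an invertible matrix. -/
theorem exists_isUnit_det_of_mul_eq_mul {W W' : Matrix (Fin m) (Fin r) ℝ}
    {H H' : Matrix (Fin r) (Fin n) ℝ} (h : W * H = W' * H') (hr : (W * H).rank = r) :
    ∃ A : Matrix (Fin r) (Fin r) ℝ, IsUnit A.det ∧ H' = A * H ∧ W' = W * A⁻¹ ∧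
      (∃ R : Matrix (Fin n) (Fin r) ℝ, H * R = 1) ∧
        ∃ L : Matrix (Fin r) (Fin m) ℝ, L * W = 1 := by
  have hrankW : ∀ (W : Matrix (Fin m) (Fin r) ℝ) (H : Matrix (Fin r) (Fin n) ℝ),
      (W * H).rank = r → W.rank = r := fun W H h =>
    (Matrix.rank_le_width W).antisymm (h.ge.trans (Matrix.rank_mul_le_left W H))
  have hrankH : ∀ (W : Matrix (Fin m) (Fin r) ℝ) (H : Matrix (Fin r) (Fin n) ℝ),
      (W * H).rank = r → Hᵀ.rank = r := fun W H h => by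
    rw [Matrix.rank_transpose]
    exact (Matrix.rank_le_height H).antisymm (h.ge.trans (Matrix.rank_mul_le_right W H))
  obtain ⟨L, hL⟩ := exists_mul_eq_one_of_rank_eq (hrankW W H hr)
  obtain ⟨L', hL'⟩ := exists_mul_eq_one_of_rank_eq (hrankW W' H' (h ▸ hr))
  obtain ⟨R, hR⟩ := exists_mul_eq_one_of_rank_eq (hrankH W H hr)
  obtain ⟨R', hR'⟩ := exists_mul_eq_one_of_rank_eq (hrankH W' H' (h ▸ hr))
  replace hR := congrArg Matrix.transpose hR
  replace hR' := congrArg Matrix.transpose hR'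
  rw [Matrix.transpose_mul, Matrix.transpose_transpose, Matrix.transpose_one] at hR hR'
  have hH : H' = L' * W * H := by
    rw [Matrix.mul_assoc, h, ← Matrix.mul_assoc, hL', Matrix.one_mul]
  -- With `A = L' * W` and `H' = A * H`, a right inverse of `H'` yields one of `A`.
  have hinv : L' * W * (H * R'ᵀ) = 1 := by
    rw [← Matrix.mul_assoc, ← hH, hR']
  have hW : W' = W * (H * R'ᵀ) := by
    rw [← Matrix.mul_assoc, h, Matrix.mul_assoc, hR', Matrix.mul_one]
  refine ⟨L' * W, Matrix.isUnit_det_of_right_inverse hinv, hH, ?_, ⟨_, hR⟩, _, hL⟩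
  rw [Matrix.inv_eq_right_inv hinv]
  exact hW

theorem span_eq_top_of_mul_eq_one {H : Matrix (Fin r) (Fin n) ℝ} {R : Matrix (Fin n) (Fin r) ℝ}
    (h : H * R = 1) {P : Set (EuclideanSpace ℝ (Fin r))}
    (hP : ∀ j, WithLp.toLp 2 (fun k => H k j) ∈ P) : Submodule.span ℝ P = ⊤ := by
  rw [Submodule.eq_top_iff']
  intro x
  have hx : x = ∑ j, (R *ᵥ x.ofLp) j • WithLp.toLp 2 fun k => H k j := by
    have h1 : H *ᵥ (R *ᵥ x.ofLp) = x.ofLp := by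
      rw [Matrix.mulVec_mulVec, h, Matrix.one_mulVec]
    ext k
    have h2 := congrFun h1 k
    rw [← h2, Matrix.mulVec_eq_sum]
    simp [mul_comm]
  rw [hx]
  exact Submodule.sum_mem _ fun j _ => Submodule.smul_mem _ _ (Submodule.subset_span (hP j))

theorem toEuclideanLin_mem_of_mem_convCols {P : Set (EuclideanSpace ℝ (Fin r))} (hP : Convex ℝ P)
    {H H' : Matrix (Fin r) (Fin n) ℝ} {A : Matrix (Fin r) (Fin r) ℝ} (hH' : H' = A * H)
    (hmem : ∀ j, WithLp.toLp 2 (fun k => H' k j) ∈ P) {x : EuclideanSpace ℝ (Fin r)}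
    (hx : x ∈ convCols H) : Matrix.toEuclideanLin A x ∈ P := by
  refine convexHull_min (t := Matrix.toEuclideanLin A ⁻¹' P) ?_ (hP.linear_preimage _) hx
  rintro _ ⟨j, rfl⟩
  have h := hmem j
  rw [hH'] at h
  exact h

theorem IsPolytope.convex {P : Set (EuclideanSpace ℝ (Fin r))} (hP : IsPolytope P) :
    Convex ℝ P := by
  obtain ⟨K, rfl⟩ := hP
  exact convex_convexHull ℝ _

theorem det_toEuclideanLin (A : Matrix (Fin r) (Fin r) ℝ) :
    LinearMap.det (Matrix.toEuclideanLin A) = A.det := by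
  rw [Matrix.toEuclideanLin_eq_toLin_orthonormal, LinearMap.det_toLin]

theorem SSC1.abs_det_le_one (hr : 0 < r) {P : Set (EuclideanSpace ℝ (Fin r))} (hP : IsPolytope P)
    (hspan : Submodule.span ℝ P = ⊤) {H H' : Matrix (Fin r) (Fin n) ℝ} (h1 : SSC1 P H)
    {A : Matrix (Fin r) (Fin r) ℝ} (hH' : H' = A * H)
    (hmem : ∀ j, WithLp.toLp 2 (fun k => H' k j) ∈ P) : |A.det| ≤ 1 := by
  obtain ⟨-, E, g, hM, hsub⟩ := h1
  obtain ⟨T, hT, hell⟩ := hM.exists_isMaximalEllipsoid hr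
  rw [hell] at hsub
  have := hT.abs_det_le_one hr hspan (Matrix.toEuclideanLin A) fun v hv =>
    toEuclideanLin_mem_of_mem_convCols hP.convex hH' hmem
      (hsub ⟨_, ⟨v, by simpa using hv, rfl⟩, rfl⟩)
  rwa [det_toEuclideanLin] at this

theorem SSC2.image_extremePoints_eq (hr : 0 < r) {P : Set (EuclideanSpace ℝ (Fin r))}
    (hP : IsPolytope P) (hspan : Submodule.span ℝ P = ⊤) {H H' : Matrix (Fin r) (Fin n) ℝ}
    (h1 : SSC1 P H) (h2 : SSC2 P H) {A : Matrix (Fin r) (Fin r) ℝ} (hH' : H' = A * H)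
    (hmem : ∀ j, WithLp.toLp 2 (fun k => H' k j) ∈ P) (hdet : |A.det| = 1) :
    Matrix.toEuclideanLin A '' Set.extremePoints ℝ P = Set.extremePoints ℝ P := by
  exact image_extremePoints_eq_of_SSC2 hr hP hspan h1 h2
    (LinearMap.equivOfDetNeZero (Matrix.toEuclideanLin A) (by
      rw [det_toEuclideanLin]
      intro h
      simp [h] at hdet))
    (fun x hx => toEuclideanLin_mem_of_mem_convCols hP.convex hH' hmem hx)
    ((congrArg abs (det_toEuclideanLin A)).trans hdet)

theorem diagonal_mul_self_of_sign {d : Fin r → ℝ} (hd : ∀ i, d i = 1 ∨ d i = -1) :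
    Matrix.diagonal d * Matrix.diagonal d = 1 := by
  rw [Matrix.diagonal_mul_diagonal, ← Matrix.diagonal_one]
  congr 1
  ext i
  rcases hd i with h | h <;> simp [h]

theorem permMatrix_mul_transpose (σ : Equiv.Perm (Fin r)) :
    σ.permMatrix ℝ * (σ.permMatrix ℝ)ᵀ = 1 := by
  rw [Matrix.transpose_permMatrix, ← Matrix.permMatrix_mul]
  simp

theorem inv_diagonal_mul_permMatrix {d : Fin r → ℝ} (hd : ∀ i, d i = 1 ∨ d i = -1)
    (σ : Equiv.Perm (Fin r)) :
    (Matrix.diagonal d * σ.permMatrix ℝ)⁻¹ = (σ.permMatrix ℝ)ᵀ * Matrix.diagonal d := by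
  refine Matrix.inv_eq_right_inv ?_
  rw [Matrix.mul_assoc, ← Matrix.mul_assoc (σ.permMatrix ℝ), permMatrix_mul_transpose,
    Matrix.one_mul, diagonal_mul_self_of_sign hd]

theorem IsSignedPerm.inv_transpose {A : Matrix (Fin r) (Fin r) ℝ} (h : IsSignedPerm A) :
    (A⁻¹)ᵀ = A := by
  obtain ⟨σ, d, hd, rfl⟩ := h
  rw [inv_diagonal_mul_permMatrix hd, Matrix.transpose_mul, Matrix.transpose_transpose,
    Matrix.diagonal_transpose]

/-- A PMF is identifiable if all the changes of basis that the polytopes allow are signed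
permutations. -/
theorem isIdentifiable_of_forall_isSignedPerm {X : Matrix (Fin m) (Fin n) ℝ}
    {W : Matrix (Fin m) (Fin r) ℝ} {H : Matrix (Fin r) (Fin n) ℝ}
    {PW PH : Set (EuclideanSpace ℝ (Fin r))} (hPMF : IsPMF X W H PW PH) (hr : X.rank = r)
    (h1W : SSC1 PW Wᵀ) (h1H : SSC1 PH H)
    (h : ∀ A : Matrix (Fin r) (Fin r) ℝ, IsUnit A.det →
      (SSC2 PW Wᵀ → Matrix.toEuclideanLin (A⁻¹)ᵀ '' Set.extremePoints ℝ PW =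
        Set.extremePoints ℝ PW) →
      (SSC2 PH H → Matrix.toEuclideanLin A '' Set.extremePoints ℝ PH =
        Set.extremePoints ℝ PH) → IsSignedPerm A) :
    IsIdentifiable X W H PW PH := by
  intro W' H' hPMF'
  -- For `r = 0` the ball has radius 0 and the volume argument is void, but all the factors are
  -- empty matrices.
  rcases Nat.eq_zero_or_pos r with rfl | hpos
  · exact ⟨1, fun _ => 1, fun _ => Or.inl rfl, Subsingleton.elim _ _, Subsingleton.elim _ _⟩
  have hX := hPMF.eq_mul
  obtain ⟨A, hA, hH', hW', ⟨R, hR⟩, L, hL⟩ :=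
    exists_isUnit_det_of_mul_eq_mul (hX ▸ hPMF'.eq_mul) (hX ▸ hr)
  have hLT : Wᵀ * Lᵀ = 1 := by rw [← Matrix.transpose_mul, hL, Matrix.transpose_one]
  have hW'T : W'ᵀ = (A⁻¹)ᵀ * Wᵀ := by rw [hW', Matrix.transpose_mul]
  have hspanH := span_eq_top_of_mul_eq_one hR hPMF.col_mem
  have hspanW := span_eq_top_of_mul_eq_one hLT hPMF.row_mem
  have hleH := h1H.abs_det_le_one hpos hPMF.polytope_H hspanH hH' hPMF'.col_mem
  have hleW := h1W.abs_det_le_one hpos hPMF.polytope_W hspanW hW'T hPMF'.row_mem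
  have hmul : |(A⁻¹)ᵀ.det| * |A.det| = 1 := by
    rw [Matrix.det_transpose, ← abs_mul, ← Matrix.det_mul, Matrix.nonsing_inv_mul _ hA,
      Matrix.det_one, abs_one]
  have hH1 : |A.det| = 1 := by nlinarith [abs_nonneg A.det]
  have hW1 : |(A⁻¹)ᵀ.det| = 1 := by rwa [hH1, mul_one] at hmul
  obtain ⟨σ, d, hd, hσ⟩ := h A hA
    (fun h2 => h2.image_extremePoints_eq hpos hPMF.polytope_W hspanW h1W hW'T hPMF'.row_mem hW1)
    (fun h2 => h2.image_extremePoints_eq hpos hPMF.polytope_H hspanH h1H hH' hPMF'.col_mem hH1)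
  refine ⟨σ, d, hd, ?_, ?_⟩
  · rw [hW', hσ, inv_diagonal_mul_permMatrix hd,
      Matrix.inv_eq_right_inv (diagonal_mul_self_of_sign hd), Matrix.mul_assoc]
  · rw [hH', hσ]

end Factorization

end PMF

end

theorem mainTheorem3 {m n r : ℕ} (X : Matrix (Fin m) (Fin n) ℝ) (W : Matrix (Fin m) (Fin r) ℝ)
    (H : Matrix (Fin r) (Fin n) ℝ) (PW PH : Set (EuclideanSpace ℝ (Fin r)))
    (hPMF : PMF.IsPMF X W H PW PH) (hr : X.rank = r) :
    (PMF.SSC1 PW Wᵀ → PMF.SSC1 PH H →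
      ((PMF.SSC2 PW Wᵀ ∧ PMF.IsPSOI (Set.extremePoints ℝ PW)) ∨
        (PMF.SSC2 PH H ∧ PMF.IsPSOI (Set.extremePoints ℝ PH))) →
      PMF.IsIdentifiable X W H PW PH) ∧
    (PMF.IsSSF PW Wᵀ → PMF.IsSSF PH H →
      PMF.IsMutuallyPSOI (Set.extremePoints ℝ PW) (Set.extremePoints ℝ PH) →
      PMF.IsIdentifiable X W H PW PH) := by
  refine ⟨fun h1W h1H h => ?_, fun hW hH h => ?_⟩
  · refine PMF.isIdentifiable_of_forall_isSignedPerm hPMF hr h1W h1H fun A hA hAW hAH => ?_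
    rcases h with ⟨h2, hP⟩ | ⟨h2, hP⟩
    · have hs := hP _ (hAW h2)
      -- In case (i) it is `(A⁻¹)ᵀ` that is a signed permutation; being orthogonal, it equals its
      -- own inverse transpose, which is `A`.
      have := hs.inv_transpose
      rw [← Matrix.transpose_nonsing_inv, Matrix.nonsing_inv_nonsing_inv A hA,
        Matrix.transpose_transpose] at this
      rwa [← this] at hs
    · exact hP A (hAH h2)
  · exact PMF.isIdentifiable_of_forall_isSignedPerm hPMF hr hW.1 hH.1 fun A hA hAW hAH =>
      h A hA (hAW hW.2) (hAH hH.2)
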